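/- Let $n\ge 1$ and $N=2n$, and let $(u,v)=\sum_{i=1}^N u_iv_i$ on $\mathbb{C}^N$. For $u\in\mathbb{C}^N$ put $\bar u=(u_{n+1},\dots,u_{2n},-u_1,\dots,-u_n)$. Let $\mathfrak{sp}_N\subseteq\mathfrak{gl}_N(\mathbb{C})$ be the symplectic Lie algebra, spanned by $h_i=e_{i,i}-e_{n+i,n+i}$, $X_{\epsilon_i-\epsilon_j}=e_{i,j}-e_{n+j,n+i}$ ($i\ne j$), $X_{\epsilon_k+\epsilon_l}=e_{k,n+l}+e_{l,n+k}$ and $X_{-\epsilon_k-\epsilon_l}=e_{n+k,l}+e_{n+l,k}$ ($k\le l$); viewing vectors as columns, $r\bar r^{\,t}\in\mathfrak{sp}_N$ for every $r\in\mathbb{Z}^N$. Let $\alpha_i^\vee=h_i-h_{i+1}$ ($i<n$) and $\alpha_n^\vee=h_n$ be the simple coroots, $\delta_1,\dots,\delta_n$ the fundamental weights, $\delta_k(\alpha_j^\vee)=\delta_{k,j}$, and $\delta_0=0$. For $0\le k\le n$ let $V(\delta_k)$ be the irreducible highest weight $\mathfrak{sp}_N$-module of highest weight $\delta_k$, with respect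 to the positive root vectors $X_{\epsilon_i-\epsilon_j}$ ($i<j$) and $X_{\epsilon_i+\epsilon_j}$ ($i\le j$). Let $A_N=\mathbb{C}[t_1^{\pm1},\dots,t_N^{\pm1}]$, $d_i=t_i\,\partial/\partial t_i$, and $H_r=\sum_{i=1}^N \bar r_i\,t^r d_i\in \mathrm{Der}(A_N)$ for $r\in\mathbb{Z}^N$. The Hamiltonian Lie algebra $\mathfrak{H}_N\subseteq\mathrm{Der}(A_N)$ is the linear span of all $H_r$, $r\in\mathbb{Z}^N\setminus\{0\}$, and $d_1,\dots,d_N$; it satisfies $[H_r,H_s]=(\bar r,s)H_{r+s}$. For $\alpha,\beta\in\mathbb{C}^N$ and an $\mathfrak{sp}_N$-module $V$, let $F^{\alpha,\beta}(V)$ be the $\mathfrak{H}_N$-module $V\otimes A_N$ with the action $$H_r(v\otimes t^s)=\big((\bar r,s+\alpha)\,v+(r\bar r^{\,t})v\big)\otimes t^{r+s},\qquad d_i(v\otimes t^s)=(s_i+\beta_i)\,v\otimes t^s$$ for $r,s\in\mathbb{Z}^N$, $v\in V$, $1\le i\le N$. **Theorem.** Let $\alpha,\beta\in\mathbb{C}^N$,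 and let $V$ be an irreducible $\mathfrak{sp}_N$-module, of finite or infinite dimension, that is not isomorphic to any of the modules $V(\delta_k)$, $0\le k\le n$. Then the $\mathfrak{H}_N$-module $F^{\alpha,\beta}(V)$ is irreducible. -/

import Mathlib

open scoped TensorProduct

attribute [local instance 100] LieRing.ofAssociativeRing

namespace Hamiltonian

noncomputable section

/-! ### Index set, the bar operation, the bilinear form

`Idx n = Fin n ⊕ Fin n` is the index set of size `N = 2n`; `Sum.inl i` is the index `i` and
`Sum.inr i` is the index `n + i`. -/

/-- The index set `{1, …, n} ⊔ {n + 1, …, 2n}`. -/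
abbrev Idx (n : ℕ) : Type := Fin n ⊕ Fin n

/-- The lattice `ℤ^N`, `N = 2n`. -/
abbrev Lat (n : ℕ) : Type := Idx n → ℤ

/-- The vector space `ℂ^N`, `N = 2n`. -/
abbrev Vec (n : ℕ) : Type := Idx n → ℂ

variable {n : ℕ}

/-- The inclusion of `ℤ^N` in `ℂ^N`. -/
def toVec (r : Lat n) : Vec n := fun i => (r i : ℂ)

/-- `bar (r', r'') = (r'', -r')`. -/
def bar (u : Vec n) : Vec n := Sum.elim (fun i => u (Sum.inr i)) (fun i => -u (Sum.inl i))

@[simp] lemma toVec_apply (r : Lat n) (i : Idx n) : toVec r i = (r i : ℂ) := rfl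

@[simp] lemma toVec_zero : toVec (0 : Lat n) = 0 := by ext; simp

lemma toVec_add (r s : Lat n) : toVec (r + s) = toVec r + toVec s := by ext; simp

@[simp] lemma bar_inl (u : Vec n) (i : Fin n) : bar u (Sum.inl i) = u (Sum.inr i) := rfl

@[simp] lemma bar_inr (u : Vec n) (i : Fin n) : bar u (Sum.inr i) = -u (Sum.inl i) := rfl

@[simp] lemma bar_zero : bar (0 : Vec n) = 0 := by
  ext i; rcases i with i | i <;> simp

lemma bar_add (u v : Vec n) : bar (u + v) = bar u + bar v := by
  ext i; rcases i with i | i <;> simp [add_comm]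

lemma bar_dot (u v : Vec n) : bar u ⬝ᵥ v = -(bar v ⬝ᵥ u) := by
  simp only [dotProduct, Fintype.sum_sum_type, bar_inl, bar_inr, neg_mul, Finset.sum_neg_distrib]
  simp only [mul_comm]
  ring

lemma bar_ne_zero {r : Lat n} (hr : r ≠ 0) : bar (toVec r) ≠ 0 := by
  intro h
  apply hr
  ext i
  rcases i with i | i
  · have := congrFun h (Sum.inr i)
    simpa using this
  · have := congrFun h (Sum.inl i)
    simpa using this

/-! ### The symplectic Lie algebra and its fundamental modules -/

variable (n) in
/-- The symplectic Lie algebra `𝔰𝔭_N ⊆ 𝔤𝔩_N`, `N = 2n`. -/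
abbrev sp : LieSubalgebra ℂ (Matrix (Idx n) (Idx n) ℂ) := LieAlgebra.Symplectic.sp (Fin n) ℂ

lemma mem_sp (A : Matrix (Idx n) (Idx n) ℂ) :
    A ∈ sp n ↔ A.transpose * Matrix.J (Fin n) ℂ = Matrix.J (Fin n) ℂ * (-A) := by
  rw [sp, LieAlgebra.Symplectic.sp, mem_skewAdjointMatricesLieSubalgebra,
    mem_skewAdjointMatricesSubmodule]
  rfl

lemma fromBlocks_mem_sp (A B C : Matrix (Fin n) (Fin n) ℂ) (hB : B.transpose = B)
    (hC : C.transpose = C) : Matrix.fromBlocks A B C (-A.transpose) ∈ sp n := by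
  rw [mem_sp, Matrix.J, Matrix.fromBlocks_transpose, Matrix.fromBlocks_neg,
    Matrix.fromBlocks_multiply, Matrix.fromBlocks_multiply]
  simp [hB, hC]

/-- `e_{i,j} - e_{n+j,n+i}`: the root vector `X_{ε_i - ε_j}` for `i ≠ j`, and `h_i` for `i = j`. -/
def xDiff (i j : Fin n) : sp n :=
  ⟨Matrix.single (Sum.inl i) (Sum.inl j) 1 - Matrix.single (Sum.inr j) (Sum.inr i) 1, by
    have h := fromBlocks_mem_sp (Matrix.single i j (1 : ℂ)) 0 0 (by simp) (by simp)
    convert h using 1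
    ext a b
    rcases a with a | a <;> rcases b with b | b <;> simp [Matrix.single_apply]⟩

/-- The root vector `X_{ε_i + ε_j} = e_{i,n+j} + e_{j,n+i}` (`i = j` allowed). -/
def xAdd (i j : Fin n) : sp n :=
  ⟨Matrix.single (Sum.inl i) (Sum.inr j) 1 + Matrix.single (Sum.inl j) (Sum.inr i) 1, by
    have h := fromBlocks_mem_sp 0 (Matrix.single i j (1 : ℂ) + Matrix.single j i (1 : ℂ)) 0
      (by simp [Matrix.transpose_single, add_comm]) (by simp)
    convert h using 1
    ext a b
    rcases a with a | a <;> rcases b with b | b <;> simp [Matrix.single_apply]⟩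

/-- The simple coroots: `α_i^∨ = h_i - h_{i+1}` for `i < n` and `α_n^∨ = h_n`
(the `i`-th one is indexed by `i - 1 : Fin n`). -/
def coroot (i : Fin n) : sp n :=
  if h : (i : ℕ) + 1 < n then xDiff i i - xDiff ⟨i + 1, h⟩ ⟨i + 1, h⟩ else xDiff i i

/-- The `𝔰𝔭_N`-module `V` is (isomorphic to) the fundamental module `V(δ_k)`, that is, the
irreducible highest weight module whose highest weight is the `k`-th fundamental weight `δ_k`
(`δ_k(α_j^∨) = 1` if `j = k` and `0` otherwise; `δ_0 = 0`): it is irreducible, and some nonzero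
vector of weight `δ_k` is annihilated by all positive root vectors `X_{ε_i - ε_j}` (`i < j`) and
`X_{ε_i + ε_j}` (`i ≤ j`). -/
def IsFundamental (n k : ℕ) (V : Type*) [AddCommGroup V] [Module ℂ V] [LieRingModule (sp n) V]
    [LieModule ℂ (sp n) V] : Prop :=
  LieModule.IsIrreducible ℂ (sp n) V ∧
    ∃ v : V, v ≠ 0 ∧
      (∀ i j : Fin n, i < j → ⁅xDiff i j, v⁆ = 0) ∧
      (∀ i j : Fin n, i ≤ j → ⁅xAdd i j, v⁆ = 0) ∧
      (∀ j : Fin n, ⁅coroot j, v⁆ = (if (j : ℕ) + 1 = k then (1 : ℂ) else 0) • v)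

/-- The rank one matrix `u ūᵗ`, an element of `𝔰𝔭_N`. -/
def rankOne (u : Vec n) : sp n :=
  ⟨Matrix.vecMulVec u (bar u), by
    have h := fromBlocks_mem_sp
      (Matrix.vecMulVec (fun i => u (Sum.inl i)) (fun i => u (Sum.inr i)))
      (-Matrix.vecMulVec (fun i => u (Sum.inl i)) (fun i => u (Sum.inl i)))
      (Matrix.vecMulVec (fun i => u (Sum.inr i)) (fun i => u (Sum.inr i)))
      (by ext; simp [Matrix.vecMulVec_apply, mul_comm])
      (by ext; simp [Matrix.vecMulVec_apply, mul_comm])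
    convert h using 1
    ext a b
    rcases a with a | a <;> rcases b with b | b <;> simp [Matrix.vecMulVec_apply, mul_comm]⟩

@[simp] lemma coe_rankOne (u : Vec n) :
    (rankOne u : Matrix (Idx n) (Idx n) ℂ) = Matrix.vecMulVec u (bar u) := rfl

@[simp] lemma rankOne_zero : rankOne (0 : Vec n) = 0 := by
  apply Subtype.ext; simp

lemma lie_rankOne (u v : Vec n) : ⁅rankOne u, rankOne v⁆ =
    (bar u ⬝ᵥ v) • (rankOne (u + v) - rankOne u - rankOne v) := by
  apply Subtype.ext
  have h : ((⁅rankOne u, rankOne v⁆ : sp n) : Matrix (Idx n) (Idx n) ℂ) =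
      Matrix.vecMulVec u (bar u) * Matrix.vecMulVec v (bar v) -
      Matrix.vecMulVec v (bar v) * Matrix.vecMulVec u (bar u) := rfl
  rw [h]
  ext a b
  have h2 := bar_dot v u
  simp only [Matrix.vecMulVec_mul_vecMulVec, h2]
  simp [Matrix.vecMulVec_apply, bar_add]
  ring

/-! ### Laurent polynomials, the Witt algebra, the Hamiltonian Lie algebra -/

variable (n) in
/-- The Laurent polynomial ring `A_N = ℂ[t_1^{±1}, …, t_N^{±1}]`. -/
abbrev Laurent : Type := AddMonoidAlgebra ℂ (Lat n)

variable (n) in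
/-- The Witt algebra `W_N = Der(A_N)`. -/
abbrev Witt : Type := Derivation ℂ (Laurent n) (Laurent n)

/-- The monomial `t^r`. -/
def mono (r : Lat n) : Laurent n := AddMonoidAlgebra.single r 1

lemma mono_mul (r s : Lat n) : mono r * mono s = mono (r + s) := by
  simp [mono, AddMonoidAlgebra.single_mul_single]

lemma laurent_hom_ext {M : Type*} [AddCommMonoid M] [Module ℂ M] {f g : Laurent n →ₗ[ℂ] M}
    (h : ∀ s, f (mono s) = g (mono s)) : f = g :=
  (AddMonoidAlgebra.basis (Lat n) ℂ).ext fun s => by simpa [mono] using h s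

/-- The linear map `t^s ↦ s_i t^s`. -/
def degLin (i : Idx n) : Laurent n →ₗ[ℂ] Laurent n :=
  (AddMonoidAlgebra.basis (Lat n) ℂ).constr ℂ fun s => (s i : ℂ) • mono s

lemma degLin_mono (i : Idx n) (s : Lat n) : degLin i (mono s) = (s i : ℂ) • mono s := by
  have := (AddMonoidAlgebra.basis (Lat n) ℂ).constr_basis ℂ
    (fun s : Lat n => (s i : ℂ) • mono s) s
  simpa [degLin, mono] using this

lemma degLin_mul (i : Idx n) (a b : Laurent n) :
    degLin i (a * b) = a • degLin i b + b • degLin i a := by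
  have h : (LinearMap.mul ℂ (Laurent n)).compr₂ (degLin i) =
      (LinearMap.mul ℂ (Laurent n)).compl₂ (degLin i) +
      ((LinearMap.mul ℂ (Laurent n)).flip.comp (degLin i)).flip.flip := by
    refine laurent_hom_ext fun r => laurent_hom_ext fun s => ?_
    simp only [LinearMap.compr₂_apply, LinearMap.mul_apply', LinearMap.add_apply,
      LinearMap.compl₂_apply, LinearMap.flip_apply, LinearMap.comp_apply, mono_mul, degLin_mono,
      mul_smul_comm]
    rw [add_comm s r, ← add_smul]
    congr 1
    push_cast [Pi.add_apply]
    ring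
  have h2 := LinearMap.congr_fun (LinearMap.congr_fun h a) b
  simpa [mul_comm] using h2

/-- The degree derivation `d_i = t_i ∂/∂t_i` of `A_N`: `d_i(t^s) = s_i t^s`. -/
def deg (i : Idx n) : Witt n := Derivation.mk' (degLin i) (degLin_mul i)

/-- The derivation `D(u, r) = ∑ i, u_i t^r d_i`. -/
def D (u : Vec n) (r : Lat n) : Witt n := ∑ i, u i • mono r • deg i

/-- The Hamiltonian derivation `H_r = D(r̄, r)`. -/
def ham (r : Lat n) : Witt n := D (bar (toVec r)) r

lemma witt_ext {P Q : Witt n} (h : ∀ s, P (mono s) = Q (mono s)) : P = Q := by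
  have h2 : (P : Laurent n →ₗ[ℂ] Laurent n) = (Q : Laurent n →ₗ[ℂ] Laurent n) :=
    laurent_hom_ext h
  exact Derivation.ext fun a => LinearMap.congr_fun h2 a

lemma deg_mono (i : Idx n) (s : Lat n) : deg i (mono s) = (s i : ℂ) • mono s := degLin_mono i s

lemma D_mono (u : Vec n) (r s : Lat n) : D u r (mono s) = (u ⬝ᵥ toVec s) • mono (r + s) := by
  have h : D u r (mono s) = ∑ i, u i • (mono r * deg i (mono s)) := by
    have := map_sum (Derivation.coeFnAddMonoidHom (R := ℂ) (A := Laurent n) (M := Laurent n))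
      (fun i => u i • mono r • deg i) Finset.univ
    have h2 := congrFun this (mono s)
    simpa [D, Derivation.coeFnAddMonoidHom] using h2
  rw [h, dotProduct, Finset.sum_smul]
  refine Finset.sum_congr rfl fun i _ => ?_
  rw [deg_mono, mul_smul_comm, mono_mul, smul_smul, toVec_apply]

lemma lie_D (u v : Vec n) (r s : Lat n) :
    ⁅D u r, D v s⁆ = D ((u ⬝ᵥ toVec s) • v - (v ⬝ᵥ toVec r) • u) (r + s) := by
  refine witt_ext fun m => ?_
  rw [Derivation.commutator_apply, D_mono, D_mono, D_mono, Derivation.map_smul,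
    Derivation.map_smul, D_mono, D_mono,
    smul_smul, smul_smul, toVec_add, toVec_add, ← add_assoc, ← add_assoc, add_comm s r, ← sub_smul]
  congr 1
  simp only [dotProduct_add, sub_dotProduct, smul_dotProduct, smul_eq_mul]
  ring

lemma ham_mono (r s : Lat n) :
    ham r (mono s) = (bar (toVec r) ⬝ᵥ toVec s) • mono (r + s) := D_mono _ r s

@[simp] lemma ham_zero : ham (0 : Lat n) = 0 := by
  refine witt_ext fun s => ?_
  simp [ham_mono]

lemma lie_ham (r s : Lat n) : ⁅ham r, ham s⁆ = (bar (toVec r) ⬝ᵥ toVec s) • ham (r + s) := by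
  refine witt_ext fun m => ?_
  rw [ham, ham, lie_D, D_mono, Derivation.smul_apply, ham_mono, smul_smul,
    bar_dot (toVec s) (toVec r)]
  congr 1
  rw [toVec_add, bar_add, neg_smul, sub_neg_eq_add, ← smul_add, smul_dotProduct, smul_eq_mul,
    add_comm (bar (toVec s))]

lemma lie_deg_ham (i : Idx n) (r : Lat n) : ⁅deg i, ham r⁆ = (r i : ℂ) • ham r := by
  refine witt_ext fun m => ?_
  rw [Derivation.commutator_apply, Derivation.smul_apply, ham_mono, deg_mono, Derivation.map_smul,
    Derivation.map_smul, deg_mono, ham_mono, smul_smul, smul_smul, smul_smul, ← sub_smul]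
  congr 1
  push_cast [Pi.add_apply]
  ring

lemma lie_deg_deg (i j : Idx n) : ⁅(deg i : Witt n), deg j⁆ = 0 := by
  refine witt_ext fun m => ?_
  rw [Derivation.commutator_apply, deg_mono, deg_mono, Derivation.map_smul, Derivation.map_smul,
    deg_mono, deg_mono,
    smul_smul, smul_smul, mul_comm, sub_self, Derivation.zero_apply]

/-- The family consisting of the `H_r`, `r ≠ 0`, and of the `d_i`. -/
def gen : {r : Lat n // r ≠ 0} ⊕ Idx n → Witt n := Sum.elim (fun r => ham r.1) deg

lemma ham_mem_span (r : Lat n) : ham r ∈ Submodule.span ℂ (Set.range (gen (n := n))) := by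
  by_cases hr : r = 0
  · subst hr
    simp
  · exact Submodule.subset_span ⟨Sum.inl ⟨r, hr⟩, rfl⟩

variable (n) in
/-- The Hamiltonian Lie algebra `𝔥_N`: the span of the `H_r`, `r ≠ 0`, and of `d_1, …, d_N` in
the Witt algebra. -/
def hamiltonian : LieSubalgebra ℂ (Witt n) where
  __ := Submodule.span ℂ (Set.range (gen (n := n)))
  lie_mem' := by
    intro P Q hP hQ
    change P ∈ Submodule.span ℂ (Set.range (gen (n := n))) at hP
    change Q ∈ Submodule.span ℂ (Set.range (gen (n := n))) at hQ
    change ⁅P, Q⁆ ∈ Submodule.span ℂ (Set.range (gen (n := n)))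
    induction hP using Submodule.span_induction with
    | zero =>
      have h : ⁅(0 : Witt n), Q⁆ = 0 := zero_lie Q
      rw [h]; exact zero_mem _
    | add x y _ _ hx hy =>
      have h : ⁅x + y, Q⁆ = ⁅x, Q⁆ + ⁅y, Q⁆ := add_lie x y Q
      rw [h]; exact add_mem hx hy
    | smul a x _ hx =>
      have h : ⁅a • x, Q⁆ = a • ⁅x, Q⁆ := smul_lie a x Q
      rw [h]; exact Submodule.smul_mem _ _ hx
    | mem x hx =>
      obtain ⟨a, rfl⟩ := hx
      induction hQ using Submodule.span_induction with
      | zero =>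
        have h : ⁅gen a, (0 : Witt n)⁆ = 0 := lie_zero (gen a)
        rw [h]; exact zero_mem _
      | add x y _ _ hx hy =>
        have h : ⁅gen a, x + y⁆ = ⁅gen a, x⁆ + ⁅gen a, y⁆ := lie_add (gen a) x y
        rw [h]; exact add_mem hx hy
      | smul c x _ hx =>
        have h : ⁅gen a, c • x⁆ = c • ⁅gen a, x⁆ := lie_smul c (gen a) x
        rw [h]; exact Submodule.smul_mem _ _ hx
      | mem y hy =>
        obtain ⟨b, rfl⟩ := hy
        rcases a with r | i <;> rcases b with s | j
        · simp only [gen, Sum.elim_inl]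
          rw [lie_ham]
          exact Submodule.smul_mem _ _ (ham_mem_span _)
        · simp only [gen, Sum.elim_inl, Sum.elim_inr]
          rw [← lie_skew, lie_deg_ham]
          exact neg_mem (Submodule.smul_mem _ _ (ham_mem_span _))
        · simp only [gen, Sum.elim_inl, Sum.elim_inr]
          rw [lie_deg_ham]
          exact Submodule.smul_mem _ _ (ham_mem_span _)
        · simp only [gen, Sum.elim_inr]
          rw [lie_deg_deg]
          exact zero_mem _

/-- `H_r` as an element of `𝔥_N` (for `r = 0` it is `0`). -/
def hamEl (r : Lat n) : hamiltonian n := ⟨ham r, ham_mem_span r⟩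

/-- `d_i` as an element of `𝔥_N`. -/
def degEl (i : Idx n) : hamiltonian n := ⟨deg i, Submodule.subset_span ⟨Sum.inr i, rfl⟩⟩

/-- Coefficient functional: on `∑ u_{r,i} t^r d_i` it takes the value `u_{r,i}`. -/
def coeffAt (r : Lat n) (i : Idx n) : Witt n →ₗ[ℂ] ℂ where
  toFun P := (P (mono (Pi.single i 1))).coeff (r + Pi.single i 1)
  map_add' P Q := by simp
  map_smul' c P := by simp

lemma coeffAt_apply (r : Lat n) (i : Idx n) (P : Witt n) :
    coeffAt r i P = (P (mono (Pi.single i 1))).coeff (r + Pi.single i 1) := rfl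

lemma coeff_mono (r s : Lat n) : (mono r).coeff s = if r = s then 1 else 0 := by
  classical
  simp [mono, Finsupp.single_apply]

lemma coeffAt_ham (r s : Lat n) (i : Idx n) :
    coeffAt s i (ham r) = if r = s then bar (toVec r) i else 0 := by
  have h : toVec (Pi.single i 1 : Lat n) = Pi.single i 1 := by
    ext j
    by_cases hj : j = i
    · subst hj; simp
    · simp [Pi.single_eq_of_ne hj]
  simp only [coeffAt_apply, ham_mono, AddMonoidAlgebra.coeff_smul,
    Finsupp.smul_apply, coeff_mono, h, dotProduct_single_one, add_left_inj]
  split_ifs <;> simp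

lemma coeffAt_deg (j : Idx n) (s : Lat n) (i : Idx n) :
    coeffAt s i (deg j) = if s = 0 ∧ i = j then 1 else 0 := by
  simp only [coeffAt_apply, deg_mono, AddMonoidAlgebra.coeff_smul,
    Finsupp.smul_apply, coeff_mono]
  by_cases hs : s = 0
  · subst hs
    by_cases hi : i = j
    · subst hi; simp
    · simp [hi]
  · simp [hs]

lemma linearIndependent_gen : LinearIndependent ℂ (gen (n := n)) := by
  rw [linearIndependent_iff]
  intro l hl
  have key : ∀ (s : Lat n) (i : Idx n),
      l.sum (fun a c => c * coeffAt s i (gen a)) = 0 := by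
    intro s i
    have := congrArg (coeffAt s i) hl
    rw [Finsupp.linearCombination_apply, map_finsuppSum] at this
    simpa using this
  ext a
  rcases a with ⟨r, hr⟩ | j
  · obtain ⟨i, hi⟩ : ∃ i, bar (toVec r) i ≠ 0 := by
      by_contra! h
      exact bar_ne_zero hr (funext h)
    have h := key r i
    rw [Finsupp.sum, Finset.sum_eq_single (Sum.inl ⟨r, hr⟩)] at h
    · simpa [gen, coeffAt_ham, hi] using h
    · rintro (⟨s, hs⟩ | j) _ hne
      · have : s ≠ r := fun h => hne (by subst h; rfl)
        simp [gen, coeffAt_ham, this]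
      · simp [gen, coeffAt_deg, hr]
    · intro hn
      simp [Finsupp.notMem_support_iff.mp hn]
  · have h := key 0 j
    rw [Finsupp.sum, Finset.sum_eq_single (Sum.inr j)] at h
    · simpa [gen, coeffAt_deg] using h
    · rintro (⟨s, hs⟩ | i) _ hne
      · simp [gen, coeffAt_ham, hs]
      · have : j ≠ i := fun h => hne (by subst h; rfl)
        simp [gen, coeffAt_deg, this]
    · intro hn
      simp [Finsupp.notMem_support_iff.mp hn]

variable (n) in
/-- The basis of `𝔥_N` formed by the `H_r`, `r ≠ 0`, and the `d_i`. -/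
def hamBasis : Module.Basis ({r : Lat n // r ≠ 0} ⊕ Idx n) ℂ (hamiltonian n) :=
  Module.Basis.span linearIndependent_gen

lemma hamBasis_inl (r : {r : Lat n // r ≠ 0}) : hamBasis n (Sum.inl r) = hamEl r.1 :=
  Subtype.ext (congrArg Subtype.val (Module.Basis.span_apply linearIndependent_gen (Sum.inl r)))

lemma hamBasis_inr (i : Idx n) : hamBasis n (Sum.inr i) = degEl i :=
  Subtype.ext (congrArg Subtype.val (Module.Basis.span_apply linearIndependent_gen (Sum.inr i)))

/-! ### The Shen-Larsson module `F^{α,β}(V)` -/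

/-- The underlying vector space `V ⊗ A_N` of the module `F^{α,β}(V)`. -/
def ShenLarsson (_α _β : Vec n) (V : Type*) [AddCommGroup V] [Module ℂ V] : Type _ :=
  V ⊗[ℂ] Laurent n

section action

variable (α β : Vec n) (V : Type*) [AddCommGroup V] [Module ℂ V]

instance : AddCommGroup (ShenLarsson α β V) := inferInstanceAs (AddCommGroup (V ⊗[ℂ] Laurent n))

instance : Module ℂ (ShenLarsson α β V) := inferInstanceAs (Module ℂ (V ⊗[ℂ] Laurent n))

variable {V} in
/-- The element `v ⊗ t^s` of `F^{α,β}(V)`. -/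
def tmono (v : V) (s : Lat n) : ShenLarsson α β V := v ⊗ₜ[ℂ] mono s

variable {α β V} in
lemma shenLarsson_hom_ext {M : Type*} [AddCommMonoid M] [Module ℂ M]
    {f g : ShenLarsson α β V →ₗ[ℂ] M} (h : ∀ v s, f (tmono α β v s) = g (tmono α β v s)) :
    f = g := by
  refine TensorProduct.ext (LinearMap.ext fun v => laurent_hom_ext fun s => ?_)
  exact h v s

/-- The operator `d_i` on `F^{α,β}(V)`: `v ⊗ a ↦ v ⊗ (d_i(a) + β_i a)`. -/
def opDeg (i : Idx n) : Module.End ℂ (ShenLarsson α β V) :=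
  LinearMap.lTensor V ((deg i : Laurent n →ₗ[ℂ] Laurent n) + β i • LinearMap.id)

lemma opDeg_tmono (i : Idx n) (v : V) (s : Lat n) :
    opDeg α β V i (tmono α β v s) = ((s i : ℂ) + β i) • tmono α β v s := by
  have h : opDeg α β V i (tmono α β v s) = v ⊗ₜ[ℂ] (deg i (mono s) + β i • mono s) := rfl
  rw [h, deg_mono, ← add_smul, TensorProduct.tmul_smul]
  rfl

lemma tmono_add (v w : V) (s : Lat n) :
    tmono α β (v + w) s = tmono α β v s + tmono α β w s := TensorProduct.add_tmul _ _ _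

lemma tmono_smul (c : ℂ) (v : V) (s : Lat n) :
    tmono α β (c • v) s = c • tmono α β v s := rfl

lemma lie_opDeg_opDeg (i j : Idx n) : ⁅opDeg α β V i, opDeg α β V j⁆ = 0 := by
  refine shenLarsson_hom_ext fun v m => ?_
  rw [LieRing.of_associative_ring_bracket, LinearMap.sub_apply, Module.End.mul_apply,
    Module.End.mul_apply, opDeg_tmono, opDeg_tmono, map_smul, map_smul, opDeg_tmono, opDeg_tmono,
    smul_smul, smul_smul, mul_comm, sub_self, LinearMap.zero_apply]

variable [LieRingModule (sp n) V] [LieModule ℂ (sp n) V]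

/-- The operator `H_r` on `F^{α,β}(V)`:
`v ⊗ a ↦ v ⊗ (H_r(a) + (r̄, α) t^r a) + (r r̄ᵗ) v ⊗ t^r a`. -/
def opHam (r : Lat n) : Module.End ℂ (ShenLarsson α β V) :=
  LinearMap.lTensor V ((ham r : Laurent n →ₗ[ℂ] Laurent n) +
      (bar (toVec r) ⬝ᵥ α) • LinearMap.mulLeft ℂ (mono r)) +
    TensorProduct.map (LieModule.toEnd ℂ (sp n) V (rankOne (toVec r)))
      (LinearMap.mulLeft ℂ (mono r))

/-- `H_r (v ⊗ t^s) = ((r̄, s + α) I + r r̄ᵗ) v ⊗ t^{r+s}`. -/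
lemma opHam_tmono (r : Lat n) (v : V) (s : Lat n) :
    opHam α β V r (tmono α β v s) =
      tmono α β ((bar (toVec r) ⬝ᵥ (toVec s + α)) • v + ⁅rankOne (toVec r), v⁆) (r + s) := by
  have h : opHam α β V r (tmono α β v s) =
      v ⊗ₜ[ℂ] (ham r (mono s) + (bar (toVec r) ⬝ᵥ α) • (mono r * mono s)) +
        ⁅rankOne (toVec r), v⁆ ⊗ₜ[ℂ] (mono r * mono s) := rfl
  rw [h, ham_mono, mono_mul, ← add_smul, ← dotProduct_add, TensorProduct.tmul_smul,
    TensorProduct.smul_tmul', ← TensorProduct.add_tmul]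
  rfl

/-- The linear map `𝔥_N → End(F^{α,β}(V))` given by the operators above. -/
def actionLin : hamiltonian n →ₗ[ℂ] Module.End ℂ (ShenLarsson α β V) :=
  (hamBasis n).constr ℂ (Sum.elim (fun r => opHam α β V r.1) (opDeg α β V))

lemma opHam_zero : opHam α β V 0 = 0 := by
  refine shenLarsson_hom_ext fun v s => ?_
  rw [opHam_tmono]
  simp only [toVec_zero, bar_zero, zero_dotProduct, zero_smul, rankOne_zero, zero_lie, add_zero,
    LinearMap.zero_apply]
  exact TensorProduct.zero_tmul _ _

lemma actionLin_hamEl (r : Lat n) : actionLin α β V (hamEl r) = opHam α β V r := by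
  by_cases hr : r = 0
  · subst hr
    have : hamEl (0 : Lat n) = 0 := Subtype.ext ham_zero
    rw [this, map_zero, opHam_zero]
  · rw [← hamBasis_inl ⟨r, hr⟩, actionLin, Module.Basis.constr_basis]
    rfl

lemma actionLin_degEl (i : Idx n) : actionLin α β V (degEl i) = opDeg α β V i := by
  rw [← hamBasis_inr i, actionLin, Module.Basis.constr_basis]
  rfl

lemma lie_opHam (r s : Lat n) : ⁅opHam α β V r, opHam α β V s⁆ =
    (bar (toVec r) ⬝ᵥ toVec s) • opHam α β V (r + s) := by
  refine shenLarsson_hom_ext fun v m => ?_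
  have e1 : s + (r + m) = r + s + m := by abel
  have e2 : r + (s + m) = r + s + m := by abel
  have h0 : ⁅(⁅rankOne (toVec r), rankOne (toVec s)⁆ : sp n), v⁆ =
      ⁅rankOne (toVec r), ⁅rankOne (toVec s), v⁆⁆ - ⁅rankOne (toVec s), ⁅rankOne (toVec r), v⁆⁆ :=
    lie_lie _ _ _
  have h1 : ⁅rankOne (toVec r), ⁅rankOne (toVec s), v⁆⁆ =
      ⁅rankOne (toVec s), ⁅rankOne (toVec r), v⁆⁆ +
      (bar (toVec r) ⬝ᵥ toVec s) • (⁅rankOne (toVec r + toVec s), v⁆ - ⁅rankOne (toVec r), v⁆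
        - ⁅rankOne (toVec s), v⁆) := by
    rw [lie_rankOne, smul_lie, sub_lie, sub_lie] at h0
    rw [h0]; abel
  rw [LieRing.of_associative_ring_bracket, LinearMap.sub_apply, Module.End.mul_apply,
    Module.End.mul_apply, LinearMap.smul_apply, opHam_tmono, opHam_tmono, opHam_tmono,
    opHam_tmono, opHam_tmono, e1, e2, ← tmono_smul, sub_eq_iff_eq_add, ← tmono_add]
  congr 1
  rw [lie_add, lie_add, lie_smul, lie_smul, h1]
  have h2 := bar_dot (toVec s) (toVec r)
  simp only [toVec_add, bar_add, dotProduct_add, add_dotProduct, h2]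
  module

lemma lie_opDeg_opHam (i : Idx n) (r : Lat n) :
    ⁅opDeg α β V i, opHam α β V r⁆ = (r i : ℂ) • opHam α β V r := by
  refine shenLarsson_hom_ext fun v m => ?_
  rw [LieRing.of_associative_ring_bracket, LinearMap.sub_apply, Module.End.mul_apply,
    Module.End.mul_apply, LinearMap.smul_apply, opDeg_tmono, map_smul, opHam_tmono, opDeg_tmono,
    ← sub_smul]
  congr 1
  push_cast [Pi.add_apply]
  ring

lemma actionLin_lie (x y : hamiltonian n) :
    actionLin α β V ⁅x, y⁆ = ⁅actionLin α β V x, actionLin α β V y⁆ := by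
  have hh : ∀ r s : Lat n, ⁅hamEl r, hamEl s⁆ = (bar (toVec r) ⬝ᵥ toVec s) • hamEl (r + s) :=
    fun r s => Subtype.ext (lie_ham r s)
  have hd : ∀ (i : Idx n) (r : Lat n), ⁅degEl i, hamEl r⁆ = (r i : ℂ) • hamEl r :=
    fun i r => Subtype.ext (lie_deg_ham i r)
  have hdd : ∀ i j : Idx n, ⁅degEl i, degEl j⁆ = 0 := fun i j => Subtype.ext (lie_deg_deg i j)
  have hB : (LieModule.toEnd ℂ (hamiltonian n) (hamiltonian n)).toLinearMap.compr₂
        (actionLin α β V) =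
      (LinearMap.mul ℂ (Module.End ℂ (ShenLarsson α β V)) -
        (LinearMap.mul ℂ (Module.End ℂ (ShenLarsson α β V))).flip).compl₁₂
          (actionLin α β V) (actionLin α β V) := by
    refine LinearMap.ext_basis (hamBasis n) (hamBasis n) fun a b => ?_
    change actionLin α β V ⁅hamBasis n a, hamBasis n b⁆ =
      ⁅actionLin α β V (hamBasis n a), actionLin α β V (hamBasis n b)⁆
    rcases a with r | i <;> rcases b with s | j <;>
      simp only [hamBasis_inl, hamBasis_inr, actionLin_hamEl, actionLin_degEl]
    · rw [hh, map_smul, actionLin_hamEl, lie_opHam]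
    · rw [← lie_skew, hd, map_neg, map_smul, actionLin_hamEl, ← lie_opDeg_opHam, lie_skew]
    · rw [hd, map_smul, actionLin_hamEl, lie_opDeg_opHam]
    · rw [hdd, map_zero, lie_opDeg_opDeg]
  exact LinearMap.congr_fun (LinearMap.congr_fun hB x) y

/-- The representation of `𝔥_N` on `F^{α,β}(V) = V ⊗ A_N`: the linear extension to `𝔥_N` of
the assignment of the operators `opHam r` to `H_r` (`r ≠ 0`) and `opDeg i` to `d_i`. -/
def action : hamiltonian n →ₗ⁅ℂ⁆ Module.End ℂ (ShenLarsson α β V) :=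
  { actionLin α β V with map_lie' := fun {x y} => actionLin_lie α β V x y }

instance : LieRingModule (hamiltonian n) (ShenLarsson α β V) :=
  LieRingModule.compLieHom (ShenLarsson α β V) (action α β V)

instance : LieModule ℂ (hamiltonian n) (ShenLarsson α β V) :=
  LieModule.compLieHom (ShenLarsson α β V) (action α β V)

variable {V}

/-- The action of `H_r`: `H_r (v ⊗ t^s) = ((r̄, s + α) I + r r̄ᵗ) v ⊗ t^{r+s}`. -/
lemma hamEl_lie_tmono (r : Lat n) (v : V) (s : Lat n) :
    ⁅hamEl r, tmono α β v s⁆ =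
      tmono α β ((bar (toVec r) ⬝ᵥ (toVec s + α)) • v + ⁅rankOne (toVec r), v⁆) (r + s) := by
  have h : ⁅hamEl r, tmono α β v s⁆ = actionLin α β V (hamEl r) (tmono α β v s) := rfl
  rw [h, actionLin_hamEl, opHam_tmono]

/-- The action of `d_i`: `d_i (v ⊗ t^s) = (s_i + β_i) v ⊗ t^s`. -/
lemma degEl_lie_tmono (i : Idx n) (v : V) (s : Lat n) :
    ⁅degEl i, tmono α β v s⁆ = ((s i : ℂ) + β i) • tmono α β v s := by
  have h : ⁅degEl i, tmono α β v s⁆ = actionLin α β V (degEl i) (tmono α β v s) := rfl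
  rw [h, actionLin_degEl, opDeg_tmono]

end action

end

end Hamiltonian

namespace Hamiltonian

noncomputable section

variable {n : ℕ}

/-! ### Polarized rank one matrices -/

/-! Let `W` be a nonzero submodule of `F^{α,β}(V)`. The operators `d_i` separate degrees, so `W`
contains a nonzero homogeneous element `v ⊗ t^s`. Write `W_t ⊆ V` for the component of degree `t`.
Applying `H_{t-s-kr} H_{kr}` to `v ⊗ t^s` gives, for every integer `k`, an element of `W_t` that is
polynomial in `k` of degree at most 4 with leading coefficient `(r r̄ᵗ)² v`. Interpolation puts `(r
r̄ᵗ)² v` in every `W_t` (`square_mem_component`).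

The intersection of all `W_t` is an `𝔰𝔭_N`-submodule (`core`), because `H_r` acts as a scalar plus
`r r̄ᵗ`. If it is `V`, then `W` is everything. If it is zero, all `(r r̄ᵗ)²` kill `v`; the vectors
with this property form a submodule, so by irreducibility all `(r r̄ᵗ)²` vanish on `V`.

Such a `V` is fundamental (`exists_isFundamental`), against the hypothesis. The relations `(r r̄ᵗ)²
= 0`, polarized in `r` (`polarized_square`), make positive root vectors nilpotent, so a highest
weight vector exists even when `V` is not assumed finite dimensional. On highest vectors they force
`h_i² = h_i`, and they exclude `h_i = 0`, `h_j = 1` for `i < j`. The weight is therefore `ε_1 + ⋯ +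
ε_k = δ_k`. -/

lemma coe_sp_add (x y : sp n) : ((x + y : sp n) : Matrix (Idx n) (Idx n) ℂ) = x + y := rfl

lemma coe_sp_sub (x y : sp n) : ((x - y : sp n) : Matrix (Idx n) (Idx n) ℂ) = x - y := rfl

lemma coe_sp_smul (c : ℂ) (x : sp n) : ((c • x : sp n) : Matrix (Idx n) (Idx n) ℂ) = c • x := rfl

lemma coe_sp_sum {ι : Type*} (s : Finset ι) (f : ι → sp n) :
    ((∑ i ∈ s, f i : sp n) : Matrix (Idx n) (Idx n) ℂ) =
      ∑ i ∈ s, (f i : Matrix (Idx n) (Idx n) ℂ) :=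
  map_sum (sp n).toSubmodule.subtype f s

/-- The element `r r̄ᵗ` of `𝔰𝔭_N`, for `r ∈ ℤ^N`. -/
def latRank (r : Lat n) : sp n := rankOne (toVec r)

/-- The polarization `r s̄ᵗ + s r̄ᵗ` of `latRank`. -/
def polar (r s : Lat n) : sp n := latRank (r + s) - latRank r - latRank s

/-- The symplectic form on `ℤ^N`. -/
def form (r s : Lat n) : ℂ := bar (toVec r) ⬝ᵥ toVec s

lemma coe_latRank (r : Lat n) :
    (latRank r : Matrix (Idx n) (Idx n) ℂ) = Matrix.vecMulVec (toVec r) (bar (toVec r)) := rfl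

lemma coe_polar (r s : Lat n) : (polar r s : Matrix (Idx n) (Idx n) ℂ) =
    Matrix.vecMulVec (toVec r) (bar (toVec s)) + Matrix.vecMulVec (toVec s) (bar (toVec r)) := by
  have h : (polar r s : Matrix (Idx n) (Idx n) ℂ) =
    (latRank (r + s) : Matrix (Idx n) (Idx n) ℂ) - latRank r - latRank s := rfl
  rw [h, coe_latRank, coe_latRank, coe_latRank, toVec_add, bar_add]
  ext a b
  simp only [Matrix.sub_apply, Matrix.add_apply, Matrix.vecMulVec_apply, Pi.add_apply]
  ring

lemma latRank_add (r s : Lat n) : latRank (r + s) = latRank r + latRank s + polar r s := by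
  rw [polar]; abel

lemma polar_comm (r s : Lat n) : polar r s = polar s r := by
  rw [polar, polar, add_comm r s]; abel

lemma polar_add_left (r s t : Lat n) : polar (r + s) t = polar r t + polar s t := by
  apply Subtype.ext
  rw [coe_sp_add, coe_polar, coe_polar, coe_polar, toVec_add, bar_add]
  ext a b
  simp only [Matrix.add_apply, Matrix.vecMulVec_apply, Pi.add_apply]
  ring

lemma polar_self (r : Lat n) : polar r r = (2 : ℂ) • latRank r := by
  apply Subtype.ext
  rw [SetLike.val_smul, coe_polar, coe_latRank, two_smul]

lemma toVec_zsmul (k : ℤ) (r : Lat n) : toVec (k • r) = (k : ℂ) • toVec r := by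
  ext; simp

lemma bar_smul (c : ℂ) (u : Vec n) : bar (c • u) = c • bar u := by
  ext i; rcases i with i | i <;> simp

lemma latRank_zsmul (k : ℤ) (r : Lat n) : latRank (k • r) = ((k : ℂ) ^ 2) • latRank r := by
  apply Subtype.ext
  rw [SetLike.val_smul, coe_latRank, coe_latRank, toVec_zsmul, bar_smul]
  ext a b
  simp only [Matrix.smul_apply, Matrix.vecMulVec_apply, Pi.smul_apply, smul_eq_mul]
  ring

lemma polar_zsmul_right (k : ℤ) (r s : Lat n) : polar r (k • s) = (k : ℂ) • polar r s := by
  apply Subtype.ext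
  rw [SetLike.val_smul, coe_polar, coe_polar, toVec_zsmul, bar_smul]
  ext a b
  simp only [Matrix.smul_apply, Matrix.add_apply, Matrix.vecMulVec_apply, Pi.smul_apply,
    smul_eq_mul]
  ring

lemma form_swap (r s : Lat n) : form r s = -form s r := bar_dot _ _

lemma form_self (r : Lat n) : form r r = 0 := by
  have := form_swap r r
  linear_combination this / 2

lemma lie_latRank (r s : Lat n) : ⁅latRank r, latRank s⁆ = form r s • polar r s := by
  rw [latRank, latRank, lie_rankOne, form, polar, latRank, latRank, latRank, toVec_add]

/-- If `polar u v` is read as the product `uv` in `Sym²(ℂ^N)`, this is the Poisson bracket expanded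
by the Leibniz rule. The brackets of root vectors used below are specializations of it. -/
lemma lie_polar (u v w z : Lat n) : ⁅polar u v, polar w z⁆ =
    form v w • polar u z + form u w • polar v z + form v z • polar u w +
      form u z • polar v w := by
  apply Subtype.ext
  have h : ((⁅polar u v, polar w z⁆ : sp n) : Matrix (Idx n) (Idx n) ℂ) =
      (polar u v : Matrix (Idx n) (Idx n) ℂ) * (polar w z : Matrix (Idx n) (Idx n) ℂ) -
      (polar w z : Matrix (Idx n) (Idx n) ℂ) * (polar u v : Matrix (Idx n) (Idx n) ℂ) := rfl
  have e1 := form_swap w u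
  have e2 := form_swap w v
  have e3 := form_swap z u
  have e4 := form_swap z v
  rw [h]
  simp only [form] at *
  simp only [coe_sp_add, coe_sp_smul, coe_polar, add_mul, mul_add,
    Matrix.vecMulVec_mul_vecMulVec, e1, e2, e3, e4]
  ext a b
  simp only [Matrix.sub_apply, Matrix.add_apply, Matrix.smul_apply, Matrix.vecMulVec_apply,
    smul_eq_mul, Pi.smul_apply]
  ring

/-- The standard basis vector `e_i` of `ℤ^N`, `i ≤ n`. -/
def posVec (i : Fin n) : Lat n := Pi.single (Sum.inl i) 1

/-- The standard basis vector `e_{n+i}` of `ℤ^N`, `i ≤ n`. -/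
def negVec (i : Fin n) : Lat n := Pi.single (Sum.inr i) 1

lemma toVec_single (i : Idx n) : toVec (Pi.single i 1 : Lat n) = Pi.single i 1 := by
  ext j
  by_cases hj : j = i
  · subst hj; simp
  · simp [Pi.single_eq_of_ne hj]

lemma bar_toVec_posVec (i : Fin n) :
    bar (toVec (posVec i)) = -Pi.single (Sum.inr i) 1 := by
  rw [posVec, toVec_single]
  ext j
  rcases j with j | j
  · simp
  · by_cases hj : j = i
    · subst hj; simp
    · simp [Pi.single_apply]

lemma bar_toVec_negVec (i : Fin n) :
    bar (toVec (negVec i)) = Pi.single (Sum.inl i) 1 := by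
  rw [negVec, toVec_single]
  ext j
  rcases j with j | j
  · simp [Pi.single_apply]
  · simp

@[simp] lemma form_posVec_posVec (i j : Fin n) : form (posVec i) (posVec j) = 0 := by
  rw [form, bar_toVec_posVec, posVec, toVec_single]
  simp

@[simp] lemma form_negVec_negVec (i j : Fin n) : form (negVec i) (negVec j) = 0 := by
  rw [form, bar_toVec_negVec, negVec, toVec_single]
  simp

lemma form_negVec_posVec (i j : Fin n) :
    form (negVec i) (posVec j) = if i = j then 1 else 0 := by
  rw [form, bar_toVec_negVec, posVec, toVec_single]
  simp [Pi.single_apply, eq_comm]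

lemma form_posVec_negVec (i j : Fin n) :
    form (posVec i) (negVec j) = if i = j then -1 else 0 := by
  rw [form_swap, form_negVec_posVec]
  simp only [eq_comm (a := j)]
  split_ifs <;> simp

lemma polar_posVec_posVec (i j : Fin n) : polar (posVec i) (posVec j) = -xAdd i j := by
  apply Subtype.ext
  rw [coe_polar, bar_toVec_posVec, bar_toVec_posVec, posVec, posVec, toVec_single, toVec_single,
    Matrix.vecMulVec_neg, Matrix.vecMulVec_neg, ← Matrix.single_eq_single_vecMulVec_single,
    ← Matrix.single_eq_single_vecMulVec_single]
  exact (neg_add _ _).symm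

lemma polar_posVec_negVec (i j : Fin n) : polar (posVec i) (negVec j) = xDiff i j := by
  apply Subtype.ext
  rw [coe_polar, bar_toVec_posVec, bar_toVec_negVec, posVec, negVec, toVec_single, toVec_single,
    Matrix.vecMulVec_neg, ← Matrix.single_eq_single_vecMulVec_single,
    ← Matrix.single_eq_single_vecMulVec_single]
  exact (sub_eq_add_neg _ _).symm

/-- The matrices `r r̄ᵗ`, `r ∈ ℤ^N`, span `𝔰𝔭_N`. -/
lemma span_latRank : Submodule.span ℂ (Set.range (latRank (n := n))) = ⊤ := by
  have hpol : ∀ r s : Lat n, polar r s ∈ Submodule.span ℂ (Set.range (latRank (n := n))) :=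
    fun r s => sub_mem (sub_mem (Submodule.subset_span ⟨_, rfl⟩) (Submodule.subset_span ⟨_, rfl⟩))
      (Submodule.subset_span ⟨_, rfl⟩)
  rw [eq_top_iff]
  rintro ⟨M, hM⟩ -
  have hM' := (mem_sp M).1 hM
  have hAD : ∀ i j, M (Sum.inr i) (Sum.inr j) = -M (Sum.inl j) (Sum.inl i) := by
    intro i j
    have h := congrFun (congrFun hM' (Sum.inl i)) (Sum.inr j)
    simp [Matrix.J, Matrix.mul_apply, Fintype.sum_sum_type, Matrix.one_apply] at h
    exact h.symm
  have hB : ∀ i j, M (Sum.inl i) (Sum.inr j) = M (Sum.inl j) (Sum.inr i) := by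
    intro i j
    have h := congrFun (congrFun hM' (Sum.inr i)) (Sum.inr j)
    simp [Matrix.J, Matrix.mul_apply, Fintype.sum_sum_type, Matrix.one_apply] at h
    exact h.symm
  have hC : ∀ i j, M (Sum.inr i) (Sum.inl j) = M (Sum.inr j) (Sum.inl i) := by
    intro i j
    have h := congrFun (congrFun hM' (Sum.inl i)) (Sum.inl j)
    simp [Matrix.J, Matrix.mul_apply, Fintype.sum_sum_type, Matrix.one_apply] at h
    exact h.symm
  -- The off-diagonal blocks are symmetric and the double sum meets each unordered pair twice, hence
  -- the halves. The minus sign comes from `bar e_i = -e_{n+i}`.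
  have key : (⟨M, hM⟩ : sp n) = ∑ i, ∑ j, ((M (Sum.inl i) (Sum.inl j)) • polar (posVec i) (negVec j)
      - (M (Sum.inl i) (Sum.inr j) / 2) • polar (posVec i) (posVec j)
      + (M (Sum.inr i) (Sum.inl j) / 2) • polar (negVec i) (negVec j)) := by
    apply Subtype.ext
    simp only [coe_sp_sum, coe_sp_add, coe_sp_sub, coe_sp_smul, coe_polar, bar_toVec_posVec, bar_toVec_negVec]
    ext a b
    simp only [posVec, negVec, toVec_single, Matrix.sum_apply, Matrix.add_apply, Matrix.sub_apply,
      Matrix.smul_apply, Matrix.vecMulVec_apply, Pi.neg_apply, smul_eq_mul]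
    rcases a with a | a <;> rcases b with b | b <;>
      simp [Pi.single_apply, Finset.sum_add_distrib, mul_add, Finset.sum_ite_eq]
    · rw [hB b a]; ring
    · rw [hC b a]; ring
    · rw [hAD]
  rw [key]
  refine sum_mem fun i _ => sum_mem fun j _ => ?_
  exact add_mem (sub_mem (Submodule.smul_mem _ _ (hpol _ _)) (Submodule.smul_mem _ _ (hpol _ _)))
    (Submodule.smul_mem _ _ (hpol _ _))

/-! ### Irreducible `𝔰𝔭_N`-modules on which all `(r r̄ᵗ)²` vanish -/

section square

variable {V : Type*} [AddCommGroup V] [Module ℂ V] [LieRingModule (sp n) V]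
  [LieModule ℂ (sp n) V]

/-- A subspace stable under all `r r̄ᵗ`, `r ∈ ℤ^N`, is a submodule. -/
def submoduleOfLatRank (U : Submodule ℂ V) (h : ∀ (r : Lat n), ∀ v ∈ U, ⁅latRank r, v⁆ ∈ U) :
    LieSubmodule ℂ (sp n) V where
  __ := U
  lie_mem := by
    intro x v hv
    have hx : x ∈ Submodule.span ℂ (Set.range (latRank (n := n))) := by
      rw [span_latRank]; trivial
    induction hx using Submodule.span_induction with
    | mem x hx => obtain ⟨r, rfl⟩ := hx; exact h r v hv
    | zero => rw [zero_lie]; exact U.zero_mem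
    | add x y _ _ hx hy => rw [add_lie]; exact U.add_mem hx hy
    | smul c x _ hx => rw [smul_lie]; exact U.smul_mem c hx

lemma mem_submoduleOfLatRank (U : Submodule ℂ V)
    (h : ∀ (r : Lat n), ∀ v ∈ U, ⁅latRank r, v⁆ ∈ U) (v : V) :
    v ∈ submoduleOfLatRank U h ↔ v ∈ U := Iff.rfl

variable (n V) in
/-- The vectors annihilated by all `(r r̄ᵗ)²`, `r ∈ ℤ^N`. -/
def squareKernel : Submodule ℂ V where
  carrier := {v | ∀ r : Lat n, ⁅latRank r, ⁅latRank r, v⁆⁆ = 0}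
  add_mem' := by
    intro v w hv hw r
    rw [lie_add, lie_add, hv r, hw r, add_zero]
  zero_mem' := by intro r; simp
  smul_mem' := by
    intro c v hv r
    rw [lie_smul, lie_smul, hv r, smul_zero]

/-- The left side is the coefficient of `k` in `(latRank (r + k s))² v`, a polynomial in `k` that
vanishes at all integers. -/
lemma squareKernel_mixed {v : V} (hv : v ∈ squareKernel n V) (r s : Lat n) :
    ⁅latRank r, ⁅polar r s, v⁆⁆ + ⁅polar r s, ⁅latRank r, v⁆⁆ = 0 := by
  have h : ∀ k : ℤ, ⁅latRank (r + k • s), ⁅latRank (r + k • s), v⁆⁆ = 0 := fun k => hv _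
  have h1 := h 1
  have h2 := h (-1)
  have h3 := h 2
  have h4 := h (-2)
  simp only [latRank_add, latRank_zsmul, polar_zsmul_right, add_lie, lie_add, smul_lie,
    lie_smul] at h1 h2 h3 h4
  push_cast at h1 h2 h3 h4
  -- Five-point formula for the derivative at 0, exact in degree at most 4, from the values at `±1`
  -- and `±2`.
  linear_combination (norm := module) ((2 / 3 : ℂ) • h1 - (2 / 3 : ℂ) • h2
    - (1 / 12 : ℂ) • h3 + (1 / 12 : ℂ) • h4)

/-- Write `R`, `S`, `P` for `latRank r`, `latRank s`, `polar r s`. Since `[R, S]` is a multiple of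
`P`, moving `S` to the left in `R²S v` leaves `S R² v = 0` and a multiple of `(RP + PR) v`, which
vanishes by `squareKernel_mixed`. -/
lemma lie_mem_squareKernel (s : Lat n) (v : V) (hv : v ∈ squareKernel n V) :
    ⁅latRank s, v⁆ ∈ squareKernel n V := by
  intro r
  have h1 : ∀ w : V, ⁅latRank r, ⁅latRank s, w⁆⁆ =
      ⁅latRank s, ⁅latRank r, w⁆⁆ + form r s • ⁅polar r s, w⁆ := by
    intro w
    rw [← smul_lie, ← lie_latRank, lie_lie]
    abel
  rw [h1, lie_add, h1, hv r, lie_zero, lie_smul, zero_add, ← smul_add,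
    add_comm, squareKernel_mixed hv, smul_zero]

/-- The fully polarized form of the relations `(r r̄ᵗ)² = 0`. -/
lemma polarized_square {v : V} (hv : v ∈ squareKernel n V) (a b c d : Lat n) :
    (⁅polar a b, ⁅polar c d, v⁆⁆ + ⁅polar c d, ⁅polar a b, v⁆⁆) +
    (⁅polar a c, ⁅polar b d, v⁆⁆ + ⁅polar b d, ⁅polar a c, v⁆⁆) +
    (⁅polar a d, ⁅polar b c, v⁆⁆ + ⁅polar b c, ⁅polar a d, v⁆⁆) = 0 := by
  have h : ∀ r : Lat n, ⁅latRank r, ⁅latRank r, v⁆⁆ = 0 := fun r => hv r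
  have h0 := h (a + b + c + d)
  have t1 := h (a + b + c)
  have t2 := h (a + b + d)
  have t3 := h (a + c + d)
  have t4 := h (b + c + d)
  have d1 := h (a + b)
  have d2 := h (a + c)
  have d3 := h (a + d)
  have d4 := h (b + c)
  have d5 := h (b + d)
  have d6 := h (c + d)
  simp only [latRank_add, polar_add_left, add_lie, lie_add, h] at h0 t1 t2 t3 t4 d1 d2 d3 d4 d5 d6
  -- Inclusion-exclusion over the subsets of `{a, b, c, d}` extracts the multilinear part of a
  -- quartic form; the singletons have already been simplified away.
  linear_combination (norm := module) h0 - t1 - t2 - t3 - t4 + d1 + d2 + d3 + d4 + d5 + d6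

/-- With `R = latRank r`, `S = latRank s`, orthogonality makes `R` and `S` commute. The polarized
relation at `(r, r, s, s)` then reads `(polar r s)² = -2RS`, whose square is `4R²S² = 0`. -/
lemma polar_pow_four {r s : Lat n} (hrs : form r s = 0)
    (hV : ∀ v : V, v ∈ squareKernel n V) (v : V) :
    ⁅polar r s, ⁅polar r s, ⁅polar r s, ⁅polar r s, v⁆⁆⁆⁆ = 0 := by
  have hc : ∀ w : V, ⁅latRank r, ⁅latRank s, w⁆⁆ = ⁅latRank s, ⁅latRank r, w⁆⁆ := by
    intro w
    rw [← sub_eq_zero, ← lie_lie, lie_latRank, hrs, zero_smul, zero_lie]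
  have h2 : ∀ w : V, ⁅polar r s, ⁅polar r s, w⁆⁆ = (-2 : ℂ) • ⁅latRank r, ⁅latRank s, w⁆⁆ := by
    intro w
    have h := polarized_square (hV w) r r s s
    simp only [polar_self, smul_lie, lie_smul, hc w] at h
    rw [hc w]
    linear_combination (norm := module) (1 / 4 : ℂ) • h
  rw [h2, h2]
  simp only [lie_smul]
  rw [← hc, hV v s, lie_zero, lie_zero, smul_zero, smul_zero]

/-- A family of locally nilpotent operators that is triangular with respect to a height function
has a common zero. -/
lemma exists_common_zero {ι : Type*} [Fintype ι] [Nontrivial V] (x : ι → sp n) (ht : ι → ℕ)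
    (hnil : ∀ i, ∀ v : V, ∃ m : ℕ, ((LieModule.toEnd ℂ (sp n) V (x i)) ^ m) v = 0)
    (hcomm : ∀ i k, ht i ≤ ht k → ∀ v : V, (∀ l, ht k < ht l → ⁅x l, v⁆ = 0) →
      ⁅⁅x k, x i⁆, v⁆ = 0) :
    ∃ v : V, v ≠ 0 ∧ ∀ i, ⁅x i, v⁆ = 0 := by
  classical
  -- Induction over index sets closed under passing to greater height. Removing an index `i` of
  -- minimal height keeps this property, and the common kernel of the remaining operators is stable
  -- under `x i`. The last nonzero power of `x i` applied to `v` is then the required vector.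
  have main : ∀ (N : ℕ) (S : Finset ι), S.card = N → (∀ i ∈ S, ∀ k, ht i < ht k → k ∈ S) →
      ∃ v : V, v ≠ 0 ∧ ∀ i ∈ S, ⁅x i, v⁆ = 0 := by
    intro N
    induction N with
    | zero =>
      intro S hS _
      obtain ⟨v, hv⟩ := exists_ne (0 : V)
      rw [Finset.card_eq_zero] at hS
      subst hS
      exact ⟨v, hv, by simp⟩
    | succ N ih =>
      intro S hS hup
      have hne : S.Nonempty := Finset.card_pos.1 (by omega)
      obtain ⟨i, hi, hmin⟩ := S.exists_min_image ht hne
      obtain ⟨v, hv, hkill⟩ := ih (S.erase i) (by rw [Finset.card_erase_of_mem hi]; omega) (by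
        intro j hj k hjk
        rw [Finset.mem_erase] at hj ⊢
        refine ⟨?_, hup j hj.2 k hjk⟩
        rintro rfl
        exact absurd (hmin j hj.2) (by omega))
      have hpres : ∀ w : V, (∀ k ∈ S.erase i, ⁅x k, w⁆ = 0) →
          ∀ k ∈ S.erase i, ⁅x k, ⁅x i, w⁆⁆ = 0 := by
        intro w hw k hk
        have hk2 := (Finset.mem_erase.1 hk).2
        have h := hcomm i k (hmin k hk2) w fun l hl => hw l (Finset.mem_erase.2
          ⟨by rintro rfl; exact absurd (hmin k hk2) (by omega), hup k hk2 l hl⟩)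
        rw [lie_lie, hw k hk, lie_zero, sub_zero] at h
        exact h
      have hpow : ∀ m : ℕ, ∀ k ∈ S.erase i,
          ⁅x k, ((LieModule.toEnd ℂ (sp n) V (x i)) ^ m) v⁆ = 0 := by
        intro m
        induction m with
        | zero => simpa using hkill
        | succ m ihm =>
          rw [pow_succ']
          exact hpres _ ihm
      have hex := hnil i v
      have hm := Nat.find_spec hex
      obtain ⟨m, hm2⟩ : ∃ m, Nat.find hex = m + 1 := by
        refine Nat.exists_eq_succ_of_ne_zero fun h0 => hv ?_
        rw [h0] at hm
        simpa using hm
      refine ⟨((LieModule.toEnd ℂ (sp n) V (x i)) ^ m) v, Nat.find_min hex (by omega), ?_⟩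
      intro k hk
      by_cases hki : k = i
      · subst hki
        rw [hm2, pow_succ'] at hm
        exact hm
      · exact hpow m k (Finset.mem_erase.2 ⟨hki, hk⟩)
  obtain ⟨v, hv, h⟩ := main _ Finset.univ rfl (by simp)
  exact ⟨v, hv, fun i => h i (Finset.mem_univ i)⟩

/-! ### Brackets of root vectors and the highest weight -/

lemma lie_polar_posNeg_posNeg (i j k l : Fin n) :
    ⁅polar (posVec i) (negVec j), polar (posVec k) (negVec l)⁆ =
      (if j = k then (1 : ℂ) else 0) • polar (posVec i) (negVec l) +
        (if i = l then (-1 : ℂ) else 0) • polar (posVec k) (negVec j) := by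
  rw [lie_polar, form_negVec_posVec, form_posVec_negVec, polar_comm (negVec j) (posVec k)]
  simp

lemma lie_polar_posNeg_posPos (i j k l : Fin n) :
    ⁅polar (posVec i) (negVec j), polar (posVec k) (posVec l)⁆ =
      (if j = k then (1 : ℂ) else 0) • polar (posVec i) (posVec l) +
        (if j = l then (1 : ℂ) else 0) • polar (posVec i) (posVec k) := by
  rw [lie_polar, form_negVec_posVec, form_negVec_posVec]
  simp

lemma lie_polar_posPos_posPos (i j k l : Fin n) :
    ⁅polar (posVec i) (posVec j), polar (posVec k) (posVec l)⁆ = 0 := by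
  rw [lie_polar]
  simp

variable (n V) in
/-- The vectors annihilated by all positive root vectors. -/
def highestVectors : Submodule ℂ V where
  carrier := {v | (∀ i j : Fin n, i < j → ⁅polar (posVec i) (negVec j), v⁆ = 0) ∧
    ∀ i j : Fin n, ⁅polar (posVec i) (posVec j), v⁆ = 0}
  add_mem' := by
    rintro v w ⟨h1, h2⟩ ⟨h3, h4⟩
    refine ⟨fun i j hij => ?_, fun i j => ?_⟩
    · rw [lie_add, h1 i j hij, h3 i j hij, add_zero]
    · rw [lie_add, h2, h4, add_zero]
  zero_mem' := by simp
  smul_mem' := by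
    rintro c v ⟨h1, h2⟩
    refine ⟨fun i j hij => ?_, fun i j => ?_⟩
    · rw [lie_smul, h1 i j hij, smul_zero]
    · rw [lie_smul, h2, smul_zero]

lemma lie_mem_highestVectors (a : Fin n) (v : V) (hv : v ∈ highestVectors n V) :
    ⁅polar (posVec a) (negVec a), v⁆ ∈ highestVectors n V := by
  obtain ⟨h1, h2⟩ := hv
  refine ⟨fun i j hij => ?_, fun i j => ?_⟩
  · rw [leibniz_lie, h1 i j hij, lie_zero, add_zero, lie_polar_posNeg_posNeg, add_lie, smul_lie,
      smul_lie]
    have e1 : (if j = a then (1 : ℂ) else 0) • ⁅polar (posVec i) (negVec a), v⁆ = 0 := by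
      split_ifs with h
      · subst h; rw [h1 i j hij, smul_zero]
      · rw [zero_smul]
    have e2 : (if i = a then (-1 : ℂ) else 0) • ⁅polar (posVec a) (negVec j), v⁆ = 0 := by
      split_ifs with h
      · subst h; rw [h1 i j hij, smul_zero]
      · rw [zero_smul]
    rw [e1, e2, add_zero]
  · rw [leibniz_lie, h2, lie_zero, add_zero, ← lie_skew, lie_polar_posNeg_posPos, neg_lie, add_lie,
      smul_lie, smul_lie, h2, h2, smul_zero, smul_zero, add_zero, neg_zero]

lemma exists_highestVector [Nontrivial V] (hV : ∀ v : V, v ∈ squareKernel n V) :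
    ∃ v ∈ highestVectors n V, v ≠ 0 := by
  let x : {p : Fin n × Fin n // p.1 < p.2} ⊕ (Fin n × Fin n) → sp n :=
    Sum.elim (fun p => polar (posVec p.1.1) (negVec p.1.2))
      (fun p => polar (posVec p.1) (posVec p.2))
  -- This is the linear functional `ε_i ↦ n - i`, with `i` counted from 0. It is positive on
  -- positive roots, so the natural subtraction never truncates, and a nonzero bracket of two root
  -- vectors has height greater than both.
  let ht : {p : Fin n × Fin n // p.1 < p.2} ⊕ (Fin n × Fin n) → ℕ :=
    Sum.elim (fun p => (p.1.2 : ℕ) - p.1.1) (fun p => 2 * n - p.1 - p.2)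
  have hnil : ∀ r s : Lat n, form r s = 0 →
      ∀ v : V, ∃ m : ℕ, ((LieModule.toEnd ℂ (sp n) V (polar r s)) ^ m) v = 0 :=
    fun r s hrs v => ⟨4, polar_pow_four hrs hV v⟩
  obtain ⟨v, hv, hkill⟩ := exists_common_zero (V := V) x ht (by
    rintro (⟨⟨i, j⟩, hij⟩ | ⟨i, j⟩)
    · exact hnil _ _ (by rw [form_posVec_negVec, if_neg (ne_of_lt hij)])
    · exact hnil _ _ (form_posVec_posVec i j)) (by
    intro a b hab v hk
    have hD : ∀ i j : Fin n, i < j → ht b < (j : ℕ) - i →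
        ⁅polar (posVec i) (negVec j), v⁆ = 0 := fun i j hij h => hk (Sum.inl ⟨(i, j), hij⟩) h
    have hA : ∀ i j : Fin n, ht b < 2 * n - i - j →
        ⁅polar (posVec i) (posVec j), v⁆ = 0 := fun i j h => hk (Sum.inr (i, j)) h
    have hite : ∀ (p : Prop) [Decidable p] (c : ℂ) (w : V), (p → w = 0) →
        (if p then c else 0) • w = 0 := by
      intro p _ c w h
      split_ifs with hp
      · rw [h hp, smul_zero]
      · rw [zero_smul]
    rcases a with ⟨⟨i, j⟩, hij⟩ | ⟨i, j⟩ <;> rcases b with ⟨⟨k, l⟩, hkl⟩ | ⟨k, l⟩ <;>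
      simp only [x, ht, Sum.elim_inl, Sum.elim_inr] at hab hD hA ⊢
    · simp only [Fin.lt_def] at hij hkl hD
      rw [lie_polar_posNeg_posNeg, add_lie, smul_lie, smul_lie, hite, hite, add_zero]
      · intro h
        have := congrArg Fin.val h
        exact hD _ _ (by omega) (by omega)
      · intro h
        have := congrArg Fin.val h
        exact hD _ _ (by omega) (by omega)
    · simp only [Fin.lt_def] at hij
      rw [← lie_skew, lie_polar_posNeg_posPos, neg_lie, add_lie, smul_lie, smul_lie, hite, hite,
        add_zero, neg_zero]
      · intro h
        have := congrArg Fin.val h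
        exact hA _ _ (by omega)
      · intro h
        have := congrArg Fin.val h
        exact hA _ _ (by omega)
    · simp only [Fin.lt_def] at hkl
      rw [lie_polar_posNeg_posPos, add_lie, smul_lie, smul_lie, hite, hite, add_zero]
      · intro h
        have := congrArg Fin.val h
        exact hA _ _ (by omega)
      · intro h
        have := congrArg Fin.val h
        exact hA _ _ (by omega)
    · rw [lie_polar_posPos_posPos, zero_lie])
  exact ⟨v, ⟨fun i j hij => hkill (Sum.inl ⟨(i, j), hij⟩), fun i j => hkill (Sum.inr (i, j))⟩, hv⟩

/-- Polarized relation at `(e_i, e_i, e_{n+i}, e_{n+i})`: the terms in `latRank (posVec i)` and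
`latRank (negVec i)` reduce to `-4 h_i v`, because the former kills `v`, and the others give `4 h_i²
v`. -/
lemma cartan_idempotent (hV : ∀ v : V, v ∈ squareKernel n V) {v : V}
    (hv : v ∈ highestVectors n V) (i : Fin n) :
    ⁅polar (posVec i) (negVec i), ⁅polar (posVec i) (negVec i), v⁆⁆ =
      ⁅polar (posVec i) (negVec i), v⁆ := by
  have h0 : ⁅latRank (posVec i), v⁆ = 0 := by
    have h := hv.2 i i
    rw [polar_self, smul_lie] at h
    exact (smul_eq_zero.1 h).resolve_left two_ne_zero
  have h1 : ⁅latRank (posVec i), ⁅latRank (negVec i), v⁆⁆ =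
      -⁅polar (posVec i) (negVec i), v⁆ := by
    rw [leibniz_lie, h0, lie_zero, add_zero, lie_latRank, form_posVec_negVec, if_pos rfl, smul_lie,
      neg_one_smul]
  have h := polarized_square (hV v) (posVec i) (posVec i) (negVec i) (negVec i)
  simp only [polar_self, smul_lie, lie_smul, h0, h1, lie_zero] at h
  linear_combination (norm := module) (1 / 4 : ℂ) • h

lemma exists_weightVector [Nontrivial V] (hV : ∀ v : V, v ∈ squareKernel n V) :
    ∃ v ∈ highestVectors n V, v ≠ 0 ∧
      ∀ i : Fin n, ⁅polar (posVec i) (negVec i), v⁆ = v ∨ ⁅polar (posVec i) (negVec i), v⁆ = 0 := by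
  have hcomm : ∀ (i j : Fin n) (v : V), ⁅polar (posVec i) (negVec i),
      ⁅polar (posVec j) (negVec j), v⁆⁆ = ⁅polar (posVec j) (negVec j),
      ⁅polar (posVec i) (negVec i), v⁆⁆ := by
    intro i j v
    rw [leibniz_lie, lie_polar_posNeg_posNeg]
    by_cases h : i = j
    · subst h; simp
    · simp [h]
  have main : ∀ S : Finset (Fin n), ∃ v ∈ highestVectors n V, v ≠ 0 ∧
      ∀ i ∈ S, ⁅polar (posVec i) (negVec i), v⁆ = v ∨ ⁅polar (posVec i) (negVec i), v⁆ = 0 := by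
    intro S
    induction S using Finset.induction_on with
    | empty =>
      obtain ⟨v, hv, h0⟩ := exists_highestVector hV
      exact ⟨v, hv, h0, by simp⟩
    | insert a S _ ih =>
      obtain ⟨v, hv, h0, h⟩ := ih
      -- If `h_a v ≠ 0`, replace `v` by `h_a v`: idempotence gives it eigenvalue 1, and as the `h_i`
      -- commute the eigenvalues already fixed persist.
      by_cases ha : ⁅polar (posVec a) (negVec a), v⁆ = 0
      · refine ⟨v, hv, h0, fun i hi => ?_⟩
        rcases Finset.mem_insert.1 hi with rfl | hi
        · exact Or.inr ha
        · exact h i hi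
      · refine ⟨_, lie_mem_highestVectors a v hv, ha, fun i hi => ?_⟩
        rcases Finset.mem_insert.1 hi with rfl | hi
        · exact Or.inl (cartan_idempotent hV hv i)
        · rw [hcomm]
          rcases h i hi with h | h
          · exact Or.inl (by rw [h])
          · exact Or.inr (by rw [h, lie_zero])
  obtain ⟨v, hv, h0, h⟩ := main Finset.univ
  exact ⟨v, hv, h0, fun i => h i (Finset.mem_univ i)⟩

/-- In the polarized relation at `(e_i, e_j, e_{n+i}, e_{n+j})` the pairing of `X_{ε_i+ε_j}` with
its opposite contributes `-(h_i + h_j) v = -v`, that of `X_{ε_i-ε_j}` contributes `(h_i - h_j) v =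
-v`, and the Cartan pairing contributes 0. Hence `-2v = 0`. -/
lemma weight_antitone (hV : ∀ v : V, v ∈ squareKernel n V) {v : V}
    (hv : v ∈ highestVectors n V) {i j : Fin n} (hij : i < j)
    (hj : ⁅polar (posVec j) (negVec j), v⁆ = v) (hi : ⁅polar (posVec i) (negVec i), v⁆ = 0) :
    v = 0 := by
  have hne := ne_of_lt hij
  have h1 : ⁅polar (posVec i) (posVec j), ⁅polar (negVec i) (negVec j), v⁆⁆ = -v := by
    rw [leibniz_lie, hv.2, lie_zero, add_zero, lie_polar]
    simp [form_posVec_negVec, hne, hne.symm, hi, hj]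
  have h2 : ⁅polar (posVec i) (negVec j), ⁅polar (posVec j) (negVec i), v⁆⁆ = -v := by
    rw [leibniz_lie, hv.1 i j hij, lie_zero, add_zero, lie_polar_posNeg_posNeg]
    simp [hi, hj]
  have h := polarized_square (hV v) (posVec i) (posVec j) (negVec i) (negVec j)
  rw [h1, hv.2, lie_zero, hj, hi, lie_zero, h2, hv.1 i j hij, lie_zero] at h
  have h3 : (2 : ℂ) • v = 0 := by
    linear_combination (norm := module) -h
  exact (smul_eq_zero.1 h3).resolve_left two_ne_zero

/-- An irreducible `𝔰𝔭_N`-module on which all `(r r̄ᵗ)²` vanish is fundamental. -/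
theorem exists_isFundamental (hirr : LieModule.IsIrreducible ℂ (sp n) V)
    (hV : ∀ v : V, v ∈ squareKernel n V) : ∃ k ≤ n, IsFundamental n k V := by
  have : Nontrivial V := by
    rw [← LieSubmodule.nontrivial_iff ℂ (sp n) V]
    infer_instance
  obtain ⟨v, hv, h0, hw⟩ := exists_weightVector hV
  -- The least such `k` is where the decreasing 0/1 sequence of eigenvalues drops to 0, so the
  -- weight is `ε_1 + ⋯ + ε_k`.
  have hex : ∃ k : ℕ, ∀ i : Fin n, k ≤ i → ⁅xDiff i i, v⁆ = 0 :=
    ⟨n, fun i hi => absurd i.2 (by omega)⟩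
  classical
  have hkn : Nat.find hex ≤ n := Nat.find_min' hex fun i hi => absurd i.2 (by omega)
  have hzero := Nat.find_spec hex
  have hone : ∀ i : Fin n, (i : ℕ) < Nat.find hex → ⁅xDiff i i, v⁆ = v := by
    intro i hi
    by_contra hne
    refine Nat.find_min hex hi fun j hj => ?_
    rw [← polar_posVec_negVec] at hne ⊢
    have hi0 := (hw i).resolve_left hne
    rcases eq_or_lt_of_le hj with h | h
    · rw [← Fin.ext h]; exact hi0
    · exact (hw j).resolve_left fun h1 => h0 (weight_antitone hV hv (Fin.lt_def.2 h) h1 hi0)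
  refine ⟨Nat.find hex, hkn, hirr, v, h0, fun i j hij => ?_, fun i j _ => ?_, fun j => ?_⟩
  · rw [← polar_posVec_negVec]; exact hv.1 i j hij
  · have h := hv.2 i j
    rw [polar_posVec_posVec, neg_lie, neg_eq_zero] at h
    exact h
  · generalize Nat.find hex = k at *
    rw [coroot]
    -- Consecutive eigenvalues differ only across position `k`; the last coroot has no successor and
    -- reads off the last eigenvalue itself.
    split_ifs with h1 h2 h2
    · rw [sub_lie, hone j (by omega), hzero _ (by simp; omega), sub_zero, one_smul]
    · rw [sub_lie, zero_smul, sub_eq_zero]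
      rcases lt_or_ge (j : ℕ) k with h | h
      · rw [hone j h, hone _ (by simp; omega)]
      · rw [hzero j h, hzero _ (by simp; omega)]
    · rw [hone j (by omega), one_smul]
    · rw [hzero j (by omega), zero_smul]

end square

/-! ### Submodules of the Shen-Larsson modules -/

section graded

variable {α β : Vec n} {V : Type*} [AddCommGroup V] [Module ℂ V]

variable (α β) in
/-- The linear map `v ↦ v ⊗ t^s`. -/
def tmonoLin (s : Lat n) : V →ₗ[ℂ] ShenLarsson α β V where
  toFun v := tmono α β v s
  map_add' v w := tmono_add α β V v w s
  map_smul' c v := tmono_smul α β V c v s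

lemma basis_apply_eq_mono (s : Lat n) : AddMonoidAlgebra.basis (Lat n) ℂ s = mono s := by
  simp [mono]

lemma exists_finsupp_tmono (x : ShenLarsson α β V) :
    ∃ b : Lat n →₀ V, b.sum (fun s v => tmono α β v s) = x := by
  obtain ⟨b, hb⟩ := TensorProduct.eq_repr_basis_right (AddMonoidAlgebra.basis (Lat n) ℂ) x
  refine ⟨b, ?_⟩
  rw [← hb]
  refine Finsupp.sum_congr fun s _ => ?_
  rw [basis_apply_eq_mono]
  rfl

lemma tmono_ne_zero {v : V} (hv : v ≠ 0) (s : Lat n) : tmono α β v s ≠ 0 := by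
  intro h
  have h2 := TensorProduct.equivFinsuppOfBasisRight_apply_tmul_apply (R := ℂ)
    (AddMonoidAlgebra.basis (Lat n) ℂ) v (mono s) s
  have h3 : v ⊗ₜ[ℂ] mono s = 0 := h
  rw [h3, ← basis_apply_eq_mono, Module.Basis.repr_self, Finsupp.single_eq_same, one_smul] at h2
  exact hv (h2.symm.trans (by simp))

variable [LieRingModule (sp n) V] [LieModule ℂ (sp n) V]

/-- The component of degree `s` of a submodule of `F^{α,β}(V)`. -/
def component (W : LieSubmodule ℂ (hamiltonian n) (ShenLarsson α β V)) (s : Lat n) :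
    Submodule ℂ V := W.toSubmodule.comap (tmonoLin α β s)

lemma mem_component (W : LieSubmodule ℂ (hamiltonian n) (ShenLarsson α β V)) (s : Lat n) (v : V) :
    v ∈ component W s ↔ tmono α β v s ∈ W := Iff.rfl

/-- Separation of degrees: if `s` and another degree `s'` differ in coordinate `i`, then `d_i - (s_i
+ β_i)` removes the term at `s` and keeps the one at `s'`, giving a shorter nonempty sum in `W`. -/
lemma exists_component_ne_zero_of_sum (W : LieSubmodule ℂ (hamiltonian n) (ShenLarsson α β V)) :
    ∀ (N : ℕ) (S : Finset (Lat n)) (b : Lat n → V), S.card = N → S.Nonempty →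
      (∀ s ∈ S, b s ≠ 0) → ∑ s ∈ S, tmono α β (b s) s ∈ W →
      ∃ s, ∃ v ∈ component W s, v ≠ 0 := by
  classical
  intro N
  induction N using Nat.strong_induction_on with
  | _ N ih =>
    intro S b hS hne hb hW
    obtain ⟨s, hs⟩ := hne
    by_cases h1 : ∃ s' ∈ S, s' ≠ s
    · obtain ⟨s', hs', hss⟩ := h1
      obtain ⟨i, hi⟩ := Function.ne_iff.1 hss
      let T := S.filter fun r => r i ≠ s i
      have hT : T ⊂ S := Finset.filter_ssubset.2 ⟨s, hs, by simp⟩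
      refine ih T.card (hS ▸ Finset.card_lt_card hT) T
        (fun r => ((r i : ℂ) - (s i : ℂ)) • b r) rfl ⟨s', Finset.mem_filter.2 ⟨hs', hi⟩⟩ ?_ ?_
      · intro r hr
        have hr' := Finset.mem_filter.1 hr
        refine smul_ne_zero (sub_ne_zero.2 ?_) (hb r hr'.1)
        exact_mod_cast hr'.2
      · have h2 : ⁅degEl i, ∑ r ∈ S, tmono α β (b r) r⁆ -
            ((s i : ℂ) + β i) • ∑ r ∈ S, tmono α β (b r) r ∈ W :=
          W.sub_mem (W.lie_mem hW) (W.smul_mem _ hW)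
        convert h2 using 1
        rw [lie_sum, Finset.smul_sum, ← Finset.sum_sub_distrib, Finset.sum_filter]
        refine Finset.sum_congr rfl fun r _ => ?_
        rw [degEl_lie_tmono, ← sub_smul, tmono_smul]
        split_ifs with h
        · congr 1; ring
        · rw [not_not] at h
          rw [h, sub_self, zero_smul]
    · push Not at h1
      have : S = {s} := Finset.eq_singleton_iff_unique_mem.2 ⟨hs, h1⟩
      rw [this, Finset.sum_singleton] at hW
      exact ⟨s, b s, hW, hb s hs⟩

lemma exists_component_ne_zero {W : LieSubmodule ℂ (hamiltonian n) (ShenLarsson α β V)}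
    (hW : W ≠ ⊥) : ∃ s, ∃ v ∈ component W s, v ≠ 0 := by
  rw [Ne, LieSubmodule.eq_bot_iff] at hW
  push Not at hW
  obtain ⟨x, hx, hx0⟩ := hW
  obtain ⟨b, rfl⟩ := exists_finsupp_tmono x
  refine exists_component_ne_zero_of_sum W _ b.support b rfl ?_ (by simp) hx
  rw [Finsupp.support_nonempty_iff]
  rintro rfl
  exact hx0 Finsupp.sum_zero_index

lemma eq_top_of_component {W : LieSubmodule ℂ (hamiltonian n) (ShenLarsson α β V)}
    (h : ∀ s, ∀ v, v ∈ component W s) : W = ⊤ := by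
  rw [eq_top_iff]
  intro x _
  obtain ⟨b, rfl⟩ := exists_finsupp_tmono x
  exact sum_mem fun s _ => h s _

/-! ### Passing between components by the operators `H_r` -/

lemma ham_mem_component {W : LieSubmodule ℂ (hamiltonian n) (ShenLarsson α β V)} {s : Lat n}
    {v : V} (hv : v ∈ component W s) (r : Lat n) :
    (bar (toVec r) ⬝ᵥ (toVec s + α)) • v + ⁅latRank r, v⁆ ∈ component W (r + s) := by
  rw [mem_component, latRank, ← hamEl_lie_tmono]
  exact W.lie_mem hv

/-- The leading coefficient in `k` of the operators `H_{m-kr} H_{kr}` is `(r r̄ᵗ)²`. -/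
lemma square_mem_component {W : LieSubmodule ℂ (hamiltonian n) (ShenLarsson α β V)} {s : Lat n}
    {v : V} (hv : v ∈ component W s) (r t : Lat n) :
    ⁅latRank r, ⁅latRank r, v⁆⁆ ∈ component W t := by
  let a : ℂ := bar (toVec r) ⬝ᵥ (toVec s + α)
  let b : ℂ := bar (toVec (t - s)) ⬝ᵥ (toVec s + α)
  let c : ℂ := form (t - s) r
  -- The product `H_{t-s-kr} H_{kr}` applied to `v ⊗ t^s`, expanded in `k`; only the last summand
  -- reaches degree 4.
  have key : ∀ k : ℤ, (b + k * c - k * a) • ((k * a : ℂ) • v + (k ^ 2 : ℂ) • ⁅latRank r, v⁆) +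
      ((k * a : ℂ) • (⁅latRank (t - s), v⁆ - (k : ℂ) • ⁅polar (t - s) r, v⁆
          + (k ^ 2 : ℂ) • ⁅latRank r, v⁆) +
        (k ^ 2 : ℂ) • (⁅latRank (t - s), ⁅latRank r, v⁆⁆ - (k : ℂ) • ⁅polar (t - s) r, ⁅latRank r, v⁆⁆
          + (k ^ 2 : ℂ) • ⁅latRank r, ⁅latRank r, v⁆⁆)) ∈ component W t := by
    intro k
    have h := ham_mem_component (ham_mem_component hv (k • r)) ((t - s) + (-k) • r)
    have e : (t - s) + (-k) • r + (k • r + s) = t := by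
      rw [neg_smul]; abel
    rw [e] at h
    have e1 : bar (toVec (k • r)) ⬝ᵥ (toVec s + α) = k * a := by
      rw [toVec_zsmul, bar_smul, smul_dotProduct, smul_eq_mul]
    have e2 : bar (toVec ((t - s) + (-k) • r)) ⬝ᵥ (toVec (k • r + s) + α) =
        b + k * c - k * a := by
      have h0 : bar (toVec r) ⬝ᵥ toVec r = 0 := form_self r
      rw [toVec_add (t - s), toVec_add (k • r), add_assoc, bar_add, add_dotProduct, dotProduct_add,
        dotProduct_add _ _ (toVec s + α), toVec_zsmul, toVec_zsmul, bar_smul]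
      simp only [dotProduct_smul, smul_dotProduct, h0, smul_eq_mul]
      change k * c + b + _ = _
      push_cast
      ring
    rw [e1, e2] at h
    convert h using 1
    simp only [latRank_add, latRank_zsmul, polar_zsmul_right, add_lie, smul_lie, lie_add, lie_smul]
    push_cast
    module
  have k0 := key 0
  have k1 := key 1
  have k2 := key (-1)
  have k3 := key 2
  have k4 := key (-2)
  -- The fourth central difference, with weights `1, -4, 6, -4, 1`, is `4! = 24` times the
  -- coefficient of `k⁴`.
  have h := Submodule.smul_mem _ (1 / 24 : ℂ) (add_mem (sub_mem (add_mem k3 k4)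
    (Submodule.smul_mem _ (4 : ℂ) (add_mem k1 k2))) (Submodule.smul_mem _ (6 : ℂ) k0))
  convert h using 1
  push_cast
  module

/-- The intersection of all components of a submodule of `F^{α,β}(V)`. -/
def core (W : LieSubmodule ℂ (hamiltonian n) (ShenLarsson α β V)) : LieSubmodule ℂ (sp n) V :=
  submoduleOfLatRank (⨅ s, component W s) (by
    intro r v hv
    rw [Submodule.mem_iInf] at hv ⊢
    intro s
    -- Degree `s` is reached from degree `s - r` by `H_r`; its scalar part is removed because `v`
    -- also lies in the component of degree `s`.
    have h := ham_mem_component (hv (s - r)) r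
    rw [add_sub_cancel] at h
    simpa using sub_mem h (Submodule.smul_mem _ (bar (toVec r) ⬝ᵥ (toVec (s - r) + α)) (hv s)))

lemma mem_core (W : LieSubmodule ℂ (hamiltonian n) (ShenLarsson α β V)) (v : V) :
    v ∈ core W ↔ ∀ s, v ∈ component W s := by
  rw [core, mem_submoduleOfLatRank, Submodule.mem_iInf]

end graded

end

end Hamiltonian

theorem theorem1 (n : ℕ) (hn : 0 < n) (α β : Hamiltonian.Vec n)
    (V : Type*) [AddCommGroup V] [Module ℂ V]
    [LieRingModule (Hamiltonian.sp n) V] [LieModule ℂ (Hamiltonian.sp n) V]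
    (hirr : LieModule.IsIrreducible ℂ (Hamiltonian.sp n) V)
    (hV : ∀ k : ℕ, k ≤ n → ¬ Hamiltonian.IsFundamental n k V) :
    LieModule.IsIrreducible ℂ (Hamiltonian.hamiltonian n) (Hamiltonian.ShenLarsson α β V) := by
  open Hamiltonian in
  have hnt : Nontrivial V := by
    rw [← LieSubmodule.nontrivial_iff ℂ (sp n) V]
    infer_instance
  obtain ⟨v₀, hv₀⟩ := exists_ne (0 : V)
  have : Nontrivial (ShenLarsson α β V) := ⟨_, 0, tmono_ne_zero hv₀ 0⟩
  refine LieModule.IsIrreducible.mk fun W hW => ?_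
  obtain ⟨s, v, hv, hv0⟩ := exists_component_ne_zero hW
  rcases eq_bot_or_eq_top (core W) with hcore | hcore
  · exfalso
    let K : LieSubmodule ℂ (sp n) V := submoduleOfLatRank (squareKernel n V) lie_mem_squareKernel
    -- All the squares `(r r̄ᵗ)² v` lie in the core, which is zero here.
    have hvK : v ∈ K := by
      intro r
      have h : ⁅latRank r, ⁅latRank r, v⁆⁆ ∈ core W :=
        (mem_core W _).2 fun t => square_mem_component hv r t
      rwa [hcore, LieSubmodule.mem_bot] at h
    have hK : K = ⊤ := (eq_bot_or_eq_top K).resolve_left fun h => hv0 (by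
      rwa [h, LieSubmodule.mem_bot] at hvK)
    obtain ⟨k, hk, hfund⟩ := exists_isFundamental hirr fun w => by
      have hw : w ∈ K := by rw [hK]; exact LieSubmodule.mem_top w
      exact hw
    exact hV k hk hfund
  · refine eq_top_of_component fun s w => ?_
    exact (mem_core W w).1 (by rw [hcore]; exact LieSubmodule.mem_top w) s
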